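/- A graph $G=(G^0,G^1,s_G,r_G)$ consists of a set $G^0$ of vertices, a set $G^1$ of edges and maps $s_G,r_G\colon G^1\to G^0$ (source and range). A Cuntz–Krieger $G$-family in a $C^*$-algebra consists of mutually orthogonal projections $p_v$ ($v\in G^0$) and partial isometries $s_e$ ($e\in G^1$) such that (0) $s_e^*s_f=0$ for $e\neq f$ in $G^1$; (1) $s_e^*s_e=p_{r_G(e)}$ for $e\in G^1$; (2) $s_es_e^*\le p_{s_G(e)}$ for $e\in G^1$; (3) $p_v=\sum_{e\in s_G^{-1}(v)}s_es_e^*$ for every $v\in G^0$ with $0<|s_G^{-1}(v)|<\infty$. The graph algebra $C^*(G)$ is the universal $C^*$-algebra generated by a Cuntz–Krieger $G$-family. The amplification $\overline{G}$ of $G$ is the graph with vertex set $G^0$ that has edges $e(v,w)^n$, $n\in\mathbb{N}$, from $v$ to $w$ for each pair $(v,w)$ such that $G$ has an edge from $v$ to $w$, and no other edges. The transitive closure ${\tt t}G$ of $G$ is the graph with vertex set $G^0$ that is obtained from $G$ by adding one edge $e(v,w)$ from $v$ to $w$ for each pair $(v,w)$ (possibly with $v=w$) such that $G$ has a path of length at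 least $1$, but no edge, from $v$ to $w$. **Corollary.** If $G$ is a graph with finitely many vertices, then $C^*(\overline{G})$ and $C^*(\overline{{\tt t}G})$ are isomorphic as $C^*$-algebras (that is, $*$-isomorphic). -/

import Mathlib

universe u v w

/-- A directed graph: vertices, edges, and source and range maps. Parallel edges and loops are
allowed, and there is no restriction on the cardinalities. -/
structure DirGraph where
  /-- the vertices -/
  V : Type u
  /-- the edges -/
  E : Type v
  /-- the source of an edge -/
  src : E → V
  /-- the range of an edge -/
  rng : E → V

namespace DirGraph

/-- There is an edge from `v` to `w`. -/
def HasEdge (G : DirGraph) (v w : G.V) : Prop := ∃ e : G.E, G.src e = v ∧ G.rng e = w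

/-- There is a path `α₁ α₂ ⋯ αₙ` with `n ≥ 1` from `v` to `w`. -/
def HasPath (G : DirGraph) : G.V → G.V → Prop := Relation.TransGen G.HasEdge

/-- The amplification of `G`: the edges are `e(v, w)ⁿ`, one for each `n : ℕ` and each pair `(v, w)`
such that `G` has an edge from `v` to `w`. -/
def amplification (G : DirGraph.{u, v}) : DirGraph.{u, u} where
  V := G.V
  E := ℕ × {x : G.V × G.V // G.HasEdge x.1 x.2}
  src e := e.2.1.1
  rng e := e.2.1.2

/-- The transitive closure `tG` of `G`: an edge `e(v, w)` is added for each pair `(v, w)` such that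
there is a path but no edge from `v` to `w`. -/
def transClosure (G : DirGraph.{u, v}) : DirGraph.{u, max u v} where
  V := G.V
  E := G.E ⊕ {x : G.V × G.V // G.HasPath x.1 x.2 ∧ ¬ G.HasEdge x.1 x.2}
  src := Sum.elim G.src (fun x => x.1.1)
  rng := Sum.elim G.rng (fun x => x.1.2)

/-- A Cuntz–Krieger `G`-family in a C⋆-algebra `A`. The inequality `s_e s_e^* ≤ p_{s(e)}` between
projections is written in the form `p_{s(e)} (s_e s_e^*) = s_e s_e^*`. -/
structure CKFamily (G : DirGraph) (A : Type*) [NonUnitalCStarAlgebra A] where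
  /-- the projections `p_v` -/
  p : G.V → A
  /-- the partial isometries `s_e` -/
  s : G.E → A
  isStarProjection : ∀ v, IsStarProjection (p v)
  orthogonal : ∀ v w, v ≠ w → p v * p w = 0
  partialIsometry : ∀ e, s e * star (s e) * s e = s e
  ck0 : ∀ e f, e ≠ f → star (s e) * s f = 0
  ck1 : ∀ e, star (s e) * s e = p (G.rng e)
  ck2 : ∀ e, p (G.src e) * (s e * star (s e)) = s e * star (s e)
  ck3 : ∀ (v : G.V) (h : {e : G.E | G.src e = v}.Finite), {e : G.E | G.src e = v}.Nonempty →
    p v = ∑ e ∈ h.toFinset, s e * star (s e)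

namespace CKFamily

variable {G : DirGraph} {A : Type*} [NonUnitalCStarAlgebra A]

theorem norm_p_le (F : CKFamily G A) (v : G.V) : ‖F.p v‖ ≤ 1 :=
  (F.isStarProjection v).norm_le

theorem norm_s_le (F : CKFamily G A) (e : G.E) : ‖F.s e‖ ≤ 1 := by
  have h1 : ‖F.s e‖ * ‖F.s e‖ ≤ 1 := by
    rw [← CStarRing.norm_star_mul_self, F.ck1]
    exact F.norm_p_le _
  nlinarith [norm_nonneg (F.s e)]

/-- The image of a Cuntz–Krieger family under a `*`-homomorphism. -/
def map {B : Type*} [NonUnitalCStarAlgebra B] (F : CKFamily G A) (φ : A →⋆ₙₐ[ℂ] B) :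
    CKFamily G B where
  p v := φ (F.p v)
  s e := φ (F.s e)
  isStarProjection v := (F.isStarProjection v).map φ
  orthogonal v w h := by rw [← map_mul, F.orthogonal v w h, map_zero]
  partialIsometry e := by rw [← map_star, ← map_mul, ← map_mul, F.partialIsometry]
  ck0 e f h := by rw [← map_star, ← map_mul, F.ck0 e f h, map_zero]
  ck1 e := by rw [← map_star, ← map_mul, F.ck1]
  ck2 e := by rw [← map_star, ← map_mul, ← map_mul, F.ck2]
  ck3 v h hne := by
    rw [F.ck3 v h hne, map_sum]
    simp only [map_mul, map_star]

/-- A Cuntz–Krieger family that is mapped into from elements `p`, `s` by an injective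
`*`-homomorphism is pulled back to a Cuntz–Krieger family. -/
def comap {B : Type*} [NonUnitalCStarAlgebra B] (F : CKFamily G B) (φ : A →⋆ₙₐ[ℂ] B)
    (hφ : Function.Injective φ) (p : G.V → A) (s : G.E → A) (hp : ∀ v, φ (p v) = F.p v)
    (hs : ∀ e, φ (s e) = F.s e) : CKFamily G A where
  p := p
  s := s
  isStarProjection v := by
    refine ⟨hφ ?_, hφ ?_⟩
    · rw [map_mul, hp]; exact (F.isStarProjection v).isIdempotentElem
    · rw [map_star, hp]; exact (F.isStarProjection v).isSelfAdjoint
  orthogonal v w h := hφ (by rw [map_mul, hp, hp, F.orthogonal v w h, map_zero])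
  partialIsometry e := hφ (by rw [map_mul, map_mul, map_star, hs, F.partialIsometry])
  ck0 e f h := hφ (by rw [map_mul, map_star, hs, hs, F.ck0 e f h, map_zero])
  ck1 e := hφ (by rw [map_mul, map_star, hs, hp, F.ck1])
  ck2 e := hφ (by rw [map_mul, map_mul, map_star, hs, hp, F.ck2])
  ck3 v h hne := hφ (by
    rw [hp, F.ck3 v h hne, map_sum]
    simp only [map_mul, map_star, hs])

end CKFamily

/-- A C⋆-algebra in the universe of `G` together with a Cuntz–Krieger `G`-family in it. -/
structure CKPair (G : DirGraph.{u, v}) : Type (max u v + 1) where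
  /-- the C⋆-algebra -/
  carrier : Type (max u v)
  [inst : NonUnitalCStarAlgebra carrier]
  /-- the family -/
  fam : CKFamily G carrier

attribute [instance] CKPair.inst

/-- The bounded families of elements of all C⋆-algebras that carry a Cuntz–Krieger `G`-family. -/
abbrev BigProduct (G : DirGraph) : Type _ := lp (fun i : CKPair G => i.carrier) ⊤

namespace BigProduct

variable (G : DirGraph)

/-- The element of the product with components `p_v`. -/
noncomputable def p (v : G.V) : BigProduct G :=
  ⟨fun i => i.fam.p v, memℓp_infty ⟨1, by rintro _ ⟨i, rfl⟩; exact i.fam.norm_p_le v⟩⟩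

/-- The element of the product with components `s_e`. -/
noncomputable def s (e : G.E) : BigProduct G :=
  ⟨fun i => i.fam.s e, memℓp_infty ⟨1, by rintro _ ⟨i, rfl⟩; exact i.fam.norm_s_le e⟩⟩

/-- Evaluation at a component. -/
noncomputable def eval (i : CKPair G) : BigProduct G →⋆ₙₐ[ℂ] i.carrier where
  toFun x := x i
  map_smul' _ _ := rfl
  map_zero' := rfl
  map_add' _ _ := rfl
  map_mul' _ _ := rfl
  map_star' _ := rfl

theorem ext_eval {x y : BigProduct G} (h : ∀ i, eval G i x = eval G i y) : x = y :=
  lp.ext (funext h)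

/-- The universal Cuntz–Krieger family in the product. -/
noncomputable def fam : CKFamily G (BigProduct G) where
  p := p G
  s := s G
  isStarProjection v := by
    refine ⟨ext_eval G fun i => ?_, ext_eval G fun i => ?_⟩
    · rw [map_mul]; exact (i.fam.isStarProjection v).isIdempotentElem
    · rw [map_star]; exact (i.fam.isStarProjection v).isSelfAdjoint
  orthogonal v w h := ext_eval G fun i => by
    rw [map_mul, map_zero]; exact i.fam.orthogonal v w h
  partialIsometry e := ext_eval G fun i => by
    rw [map_mul, map_mul, map_star]; exact i.fam.partialIsometry e
  ck0 e f h := ext_eval G fun i => by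
    rw [map_mul, map_star, map_zero]; exact i.fam.ck0 e f h
  ck1 e := ext_eval G fun i => by
    rw [map_mul, map_star]; exact i.fam.ck1 e
  ck2 e := ext_eval G fun i => by
    rw [map_mul, map_mul, map_star]; exact i.fam.ck2 e
  ck3 v h hne := ext_eval G fun i => by
    rw [map_sum]
    simp only [map_mul, map_star]
    exact i.fam.ck3 v h hne

end BigProduct

/-- The closed `*`-subalgebra generated by a Cuntz–Krieger family. -/
noncomputable def CKFamily.generated {G : DirGraph} {A : Type*} [NonUnitalCStarAlgebra A]
    (F : CKFamily G A) : NonUnitalStarSubalgebra ℂ A :=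
  (NonUnitalStarAlgebra.adjoin ℂ (Set.range F.p ∪ Set.range F.s)).topologicalClosure

instance CKFamily.isClosed_generated {G : DirGraph} {A : Type*} [NonUnitalCStarAlgebra A]
    (F : CKFamily G A) : IsClosed (F.generated : Set A) :=
  NonUnitalStarSubalgebra.isClosed_topologicalClosure _

/-- The graph algebra `C*(G)`, the universal C⋆-algebra generated by a Cuntz–Krieger `G`-family:
the C⋆-algebra generated by the family whose components are all Cuntz–Krieger `G`-families.
`GraphAlgebra.existsUnique_lift` below is its universal property. -/
def GraphAlgebra (G : DirGraph.{u, v}) : Type (max u v + 1) := (BigProduct.fam G).generated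

noncomputable instance (G : DirGraph.{u, v}) : NonUnitalCStarAlgebra G.GraphAlgebra :=
  NonUnitalStarSubalgebra.nonUnitalCStarAlgebra (BigProduct.fam G).generated

namespace CKFamily

variable {G : DirGraph.{u, v}} {A : Type w} [NonUnitalCStarAlgebra A]

/-- `*`-polynomials in the generators without constant term. -/
inductive StarPoly (G : DirGraph.{u, v}) : Type (max u v)
  | p : G.V → StarPoly G
  | s : G.E → StarPoly G
  | zero : StarPoly G
  | add : StarPoly G → StarPoly G → StarPoly G
  | mul : StarPoly G → StarPoly G → StarPoly G
  | smul : ℂ → StarPoly G → StarPoly G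
  | star : StarPoly G → StarPoly G

/-- The value of a `*`-polynomial at a Cuntz–Krieger family. -/
def polyVal (F : CKFamily G A) : StarPoly G → A
  | .p v => F.p v
  | .s e => F.s e
  | .zero => 0
  | .add a b => F.polyVal a + F.polyVal b
  | .mul a b => F.polyVal a * F.polyVal b
  | .smul c a => c • F.polyVal a
  | .star a => Star.star (F.polyVal a)

theorem p_mem (F : CKFamily G A) (v : G.V) : F.p v ∈ F.generated :=
  NonUnitalStarSubalgebra.le_topologicalClosure _
    (NonUnitalStarAlgebra.subset_adjoin ℂ _ (Or.inl ⟨v, rfl⟩))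

theorem s_mem (F : CKFamily G A) (e : G.E) : F.s e ∈ F.generated :=
  NonUnitalStarSubalgebra.le_topologicalClosure _
    (NonUnitalStarAlgebra.subset_adjoin ℂ _ (Or.inr ⟨e, rfl⟩))

theorem small_generated (F : CKFamily G A) : Small.{max u v} F.generated := by
  have h1 : ∀ a ∈ NonUnitalStarAlgebra.adjoin ℂ (Set.range F.p ∪ Set.range F.s),
      ∃ t, F.polyVal t = a := by
    intro a ha
    induction ha using NonUnitalStarAlgebra.adjoin_induction with
    | mem x hx =>
      rcases hx with ⟨v, rfl⟩ | ⟨e, rfl⟩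
      · exact ⟨.p v, rfl⟩
      · exact ⟨.s e, rfl⟩
    | add x y _ _ hx hy =>
      obtain ⟨a, rfl⟩ := hx
      obtain ⟨b, rfl⟩ := hy
      exact ⟨.add a b, rfl⟩
    | zero => exact ⟨.zero, rfl⟩
    | mul x y _ _ hx hy =>
      obtain ⟨a, rfl⟩ := hx
      obtain ⟨b, rfl⟩ := hy
      exact ⟨.mul a b, rfl⟩
    | smul r x _ hx =>
      obtain ⟨a, rfl⟩ := hx
      exact ⟨.smul r a, rfl⟩
    | star x _ hx =>
      obtain ⟨a, rfl⟩ := hx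
      exact ⟨.star a, rfl⟩
  have h2 : ∀ a : F.generated, ∃ t : ℕ → StarPoly G,
      Filter.Tendsto (fun n => F.polyVal (t n)) Filter.atTop (nhds (a : A)) := by
    intro a
    obtain ⟨x, hx, hlim⟩ := mem_closure_iff_seq_limit.1 a.2
    choose t ht using fun n => h1 (x n) (hx n)
    exact ⟨t, by simpa only [ht] using hlim⟩
  choose t ht using h2
  refine small_of_injective (f := t) fun a b hab => Subtype.ext ?_
  have hb := ht b
  rw [← hab] at hb
  exact tendsto_nhds_unique (ht a) hb

end CKFamily

/-- A C⋆-algebra that is small has an isomorphic copy in the smaller universe. -/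
theorem exists_small_copy (A : Type w) [NonUnitalCStarAlgebra A] [Small.{u} A] :
    ∃ (B : Type u) (_ : NonUnitalCStarAlgebra B) (φ : B →⋆ₙₐ[ℂ] A), Function.Bijective φ := by
  let e : Shrink.{u} A ≃ A := (equivShrink A).symm
  let i1 : NonUnitalRing (Shrink.{u} A) := e.nonUnitalRing
  let i2 : Module ℂ (Shrink.{u} A) := e.module ℂ
  have hadd : ∀ x y, e (x + y) = e x + e y := fun x y => e.apply_symm_apply _
  have hmul : ∀ x y, e (x * y) = e x * e y := fun x y => e.apply_symm_apply _
  have hsmul : ∀ (c : ℂ) x, e (c • x) = c • e x := fun c x => e.apply_symm_apply _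
  have hzero : e 0 = 0 := e.apply_symm_apply _
  let i3 : StarRing (Shrink.{u} A) :=
    { star := fun x => e.symm (star (e x))
      star_involutive := fun x => by simp
      star_mul := fun x y => e.injective (by simp [hmul])
      star_add := fun x y => e.injective (by simp [hadd]) }
  have hstar : ∀ x, e (star x) = star (e x) := fun x => e.apply_symm_apply _
  let f : Shrink.{u} A →ₙ+* A :=
    { toFun := e, map_zero' := hzero, map_add' := hadd, map_mul' := hmul }
  let i4 : NonUnitalNormedRing (Shrink.{u} A) :=
    NonUnitalNormedRing.induced (Shrink.{u} A) A f e.injective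
  have hnorm : ∀ x : Shrink.{u} A, ‖x‖ = ‖e x‖ := fun _ => rfl
  have i5 : CompleteSpace (Shrink.{u} A) := by
    have : Isometry e := AddMonoidHomClass.isometry_of_norm f fun _ => rfl
    exact ((this.isUniformInducing).completeSpace_congr e.surjective).2 inferInstance
  let i6 : NonUnitalCStarAlgebra (Shrink.{u} A) :=
    { i4, i3, i2, i5 with
      norm_mul_self_le := fun x => by
        rw [hnorm, hnorm, hmul, hstar]
        exact (CStarRing.norm_star_mul_self (x := e x)).symm.le
      norm_smul_le := fun c x => by
        rw [hnorm, hnorm, hsmul]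
        exact norm_smul_le c (e x)
      smul_assoc := fun c x y => e.injective (by
        change e ((c • x) * y) = e (c • (x * y))
        rw [hmul, hsmul, hsmul, hmul, smul_mul_assoc])
      smul_comm := fun c x y => e.injective (by
        change e (c • (x * y)) = e (x * (c • y))
        rw [hmul, hsmul, hsmul, hmul, mul_smul_comm])
      star_smul := fun c x => e.injective (by
        change e (star (c • x)) = e (star c • star x)
        rw [hstar, hsmul, hsmul, hstar, star_smul]) }
  exact ⟨Shrink.{u} A, i6,
    { toFun := e, map_smul' := hsmul, map_zero' := hzero, map_add' := hadd, map_mul' := hmul,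
      map_star' := hstar }, e.bijective⟩

namespace GraphAlgebra

/-- The inclusion of the graph algebra into the product. -/
noncomputable def incl (G : DirGraph.{u, v}) : G.GraphAlgebra →⋆ₙₐ[ℂ] BigProduct G :=
  NonUnitalStarSubalgebraClass.subtype (BigProduct.fam G).generated

/-- The Cuntz–Krieger family that generates the graph algebra. -/
noncomputable def fam (G : DirGraph.{u, v}) : CKFamily G G.GraphAlgebra :=
  (BigProduct.fam G).comap (incl G) Subtype.val_injective
    (fun v => ⟨_, (BigProduct.fam G).p_mem v⟩) (fun e => ⟨_, (BigProduct.fam G).s_mem e⟩)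
    (fun _ => rfl) (fun _ => rfl)

/-- The universal property of the graph algebra, for C⋆-algebras in an arbitrary universe. -/
theorem existsUnique_lift {G : DirGraph.{u, v}} {A : Type w} [NonUnitalCStarAlgebra A]
    (F : CKFamily G A) : ∃! φ : G.GraphAlgebra →⋆ₙₐ[ℂ] A,
      (∀ v, φ ((fam G).p v) = F.p v) ∧ ∀ e, φ ((fam G).s e) = F.s e := by
  have := F.small_generated
  obtain ⟨B, _, j, hj⟩ := exists_small_copy.{max u v, w} F.generated
  choose p hp using fun v => hj.2 ⟨F.p v, F.p_mem v⟩
  choose s hs using fun e => hj.2 ⟨F.s e, F.s_mem e⟩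
  let ψ : B →⋆ₙₐ[ℂ] A := (NonUnitalStarSubalgebraClass.subtype F.generated).comp j
  have hψ : Function.Injective ψ := Subtype.val_injective.comp hj.1
  have hψp : ∀ v, ψ (p v) = F.p v := fun v => congrArg Subtype.val (hp v)
  have hψs : ∀ e, ψ (s e) = F.s e := fun e => congrArg Subtype.val (hs e)
  let i : CKPair G := ⟨B, F.comap ψ hψ p s hψp hψs⟩
  refine ⟨ψ.comp ((BigProduct.eval G i).comp (incl G)),
    ⟨fun v => hψp v, fun e => hψs e⟩, ?_⟩
  have key : ∀ φ₁ φ₂ : G.GraphAlgebra →⋆ₙₐ[ℂ] A, (∀ v, φ₁ ((fam G).p v) = φ₂ ((fam G).p v)) →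
      (∀ e, φ₁ ((fam G).s e) = φ₂ ((fam G).s e)) → φ₁ = φ₂ := by
    intro φ₁ φ₂ h1 h2
    have c1 : Continuous φ₁ := AddMonoidHomClass.continuous_of_bound φ₁ 1 fun x => by
      simpa using NonUnitalStarAlgHom.norm_apply_le φ₁ x
    have c2 : Continuous φ₂ := AddMonoidHomClass.continuous_of_bound φ₂ 1 fun x => by
      simpa using NonUnitalStarAlgHom.norm_apply_le φ₂ x
    have hadj : ∀ a (ha : a ∈ NonUnitalStarAlgebra.adjoin ℂ
        (Set.range (BigProduct.fam G).p ∪ Set.range (BigProduct.fam G).s)),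
        φ₁ ⟨a, NonUnitalStarSubalgebra.le_topologicalClosure _ ha⟩ =
        φ₂ ⟨a, NonUnitalStarSubalgebra.le_topologicalClosure _ ha⟩ := by
      intro a ha
      induction ha using NonUnitalStarAlgebra.adjoin_induction with
      | mem x hx =>
        rcases hx with ⟨v, rfl⟩ | ⟨e, rfl⟩
        · exact h1 v
        · exact h2 e
      | add x y hx hy ihx ihy =>
        exact (map_add φ₁ _ _).trans ((congrArg₂ (· + ·) ihx ihy).trans (map_add φ₂ _ _).symm)
      | zero => exact (map_zero φ₁).trans (map_zero φ₂).symm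
      | mul x y hx hy ihx ihy =>
        exact (map_mul φ₁ _ _).trans ((congrArg₂ (· * ·) ihx ihy).trans (map_mul φ₂ _ _).symm)
      | smul r x hx ihx =>
        exact (map_smul φ₁ r _).trans ((congrArg (r • ·) ihx).trans (map_smul φ₂ r _).symm)
      | star x hx ihx =>
        exact (map_star φ₁ _).trans ((congrArg star ihx).trans (map_star φ₂ _).symm)
    ext ⟨a, ha⟩
    obtain ⟨x, hx, hlim⟩ := mem_closure_iff_seq_limit.1 ha
    have hlim' : Filter.Tendsto (fun n => (⟨x n,
        NonUnitalStarSubalgebra.le_topologicalClosure _ (hx n)⟩ : G.GraphAlgebra))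
        Filter.atTop (nhds ⟨a, ha⟩) := tendsto_subtype_rng.2 hlim
    refine tendsto_nhds_unique ((c1.tendsto _).comp hlim') ?_
    refine ((c2.tendsto _).comp hlim').congr fun n => ?_
    exact (hadj _ (hx n)).symm
  rintro φ ⟨hφp, hφs⟩
  exact key _ _ (fun v => (hφp v).trans (hψp v).symm) (fun e => (hφs e).trans (hψs e).symm)

end GraphAlgebra

end DirGraph

/-! An amplification depends only on the relation "there is an edge from `a` to `b`", so the claim
compares the graph algebras of a relation `R` and of its transitive closure. Each vertex there emits
no edges or infinitely many, so relation (3) is vacuous and edges can be regrouped freely.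

Suppose `R x y`, `R y z` and not `R x z`. Let `f` be the edge `y → z` with index 0, `Q = f f*` and
`q = p y - Q`. On the `q`-part the edges `x → y` are kept. On the `Q`-part they are split by parity:
odd ones are renumbered as the `Q`-parts of the new edges `x → y`, and even ones, followed by `f`,
become edges `x → z`. This is reversible, and `addEdges` and `removeEdges` are the two directions.
By universality they induce mutually inverse `*`-homomorphisms (`nonempty_equiv_of_step`).

With finitely many vertices only finitely many pairs can be added, and each step preserves the
transitive closure, so the process ends there (`nonempty_equiv_transGen`). -/

namespace DirGraph

/-! ### Graph algebras determined by a relation -/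

/-- The graph with countably many edges from `a` to `b` whenever `R a b`, and no others. -/
def relGraph {V : Type u} (R : V → V → Prop) : DirGraph.{u, u} where
  V := V
  E := ℕ × {x : V × V // R x.1 x.2}
  src e := e.2.1.1
  rng e := e.2.1.2

/-- A Cuntz–Krieger `relGraph R`-family, with the partial isometries extended by zero to all pairs
of vertices. Every vertex of `relGraph R` is a sink or an infinite emitter, so there is no
summation relation. -/
structure IsRelFamily {V : Type u} {A : Type*} [NonUnitalCStarAlgebra A] (R : V → V → Prop)
    (p : V → A) (s : V → V → ℕ → A) : Prop where
  isStarProjection : ∀ a, IsStarProjection (p a)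
  orthogonal : ∀ a b, a ≠ b → p a * p b = 0
  eq_zero : ∀ a b n, ¬ R a b → s a b n = 0
  star_mul_self : ∀ a b n, R a b → star (s a b n) * s a b n = p b
  star_mul_of_ne : ∀ a b m c d n, (a, b, m) ≠ (c, d, n) → star (s a b m) * s c d n = 0
  src_mul : ∀ a b n, p a * s a b n = s a b n
  mul_rng : ∀ a b n, s a b n * p b = s a b n

namespace IsRelFamily

variable {V : Type u} {A : Type*} [NonUnitalCStarAlgebra A] {R : V → V → Prop}
  {p : V → A} {s : V → V → ℕ → A}

theorem star_p (h : IsRelFamily R p s) (a : V) : star (p a) = p a :=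
  (h.isStarProjection a).isSelfAdjoint

theorem p_mul_p (h : IsRelFamily R p s) (a : V) : p a * p a = p a :=
  (h.isStarProjection a).isIdempotentElem

/-- The Cuntz–Krieger family of a `relGraph R`-family. -/
def toCKFamily (h : IsRelFamily R p s) : CKFamily (relGraph R) A where
  p := p
  s e := s e.2.1.1 e.2.1.2 e.1
  isStarProjection := h.isStarProjection
  orthogonal := h.orthogonal
  partialIsometry e := by
    rw [mul_assoc, h.star_mul_self _ _ _ e.2.2, h.mul_rng]
  ck0 e f hef := h.star_mul_of_ne _ _ _ _ _ _ fun heq => hef <| by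
    simp only [Prod.mk.injEq] at heq
    exact Prod.ext heq.2.2 (Subtype.ext (Prod.ext heq.1 heq.2.1))
  ck1 e := h.star_mul_self _ _ _ e.2.2
  ck2 e := by
    rw [← mul_assoc]
    exact congrArg (· * _) (h.src_mul _ _ _)
  ck3 a hfin hne := by
    obtain ⟨e, he⟩ := hne
    -- Varying the index of one edge gives infinitely many edges with the same source.
    exact absurd hfin (Set.infinite_of_injective_forall_mem (f := fun n : ℕ => ((n, e.2) :
      (relGraph R).E)) (fun m n hmn => congrArg Prod.fst hmn) fun n => he)

end IsRelFamily

theorem CKFamily.p_src_mul_s {G : DirGraph.{u, v}} {A : Type*} [NonUnitalCStarAlgebra A]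
    (F : CKFamily G A) (e : G.E) : F.p (G.src e) * F.s e = F.s e := by
  conv_lhs => rw [← F.partialIsometry e, ← mul_assoc, F.ck2]
  exact F.partialIsometry e

theorem CKFamily.s_mul_p_rng {G : DirGraph.{u, v}} {A : Type*} [NonUnitalCStarAlgebra A]
    (F : CKFamily G A) (e : G.E) : F.s e * F.p (G.rng e) = F.s e := by
  rw [← F.ck1, ← mul_assoc, F.partialIsometry]

open Classical in
/-- The partial isometries of a Cuntz–Krieger `relGraph R`-family, extended by zero. -/
noncomputable def CKFamily.total {V : Type u} {A : Type*} [NonUnitalCStarAlgebra A]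
    {R : V → V → Prop} (F : CKFamily (relGraph R) A) (a b : V) (n : ℕ) : A :=
  if h : R a b then F.s (n, ⟨(a, b), h⟩) else 0

theorem CKFamily.total_of {V : Type u} {A : Type*} [NonUnitalCStarAlgebra A]
    {R : V → V → Prop} (F : CKFamily (relGraph R) A) {a b : V} (h : R a b) (n : ℕ) :
    F.total a b n = F.s (n, ⟨(a, b), h⟩) := dif_pos h

theorem CKFamily.total_of_not {V : Type u} {A : Type*} [NonUnitalCStarAlgebra A]
    {R : V → V → Prop} (F : CKFamily (relGraph R) A) {a b : V} (h : ¬ R a b) (n : ℕ) :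
    F.total a b n = 0 := dif_neg h

theorem CKFamily.isRelFamily {V : Type u} {A : Type*} [NonUnitalCStarAlgebra A]
    {R : V → V → Prop} (F : CKFamily (relGraph R) A) : IsRelFamily R F.p F.total where
  isStarProjection := F.isStarProjection
  orthogonal := F.orthogonal
  eq_zero a b n h := F.total_of_not h n
  star_mul_self a b n h := by
    rw [F.total_of h]
    exact F.ck1 _
  star_mul_of_ne a b m c d n hne := by
    by_cases h : R a b
    · by_cases h' : R c d
      · rw [F.total_of h, F.total_of h']
        refine F.ck0 _ _ fun heq => hne ?_
        have h1 := congrArg Prod.fst heq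
        have h2 := congrArg (fun e => e.2.1) heq
        simp only [Prod.mk.injEq] at h1 h2 ⊢
        exact ⟨h2.1, h2.2, h1⟩
      · rw [F.total_of_not h', mul_zero]
    · rw [F.total_of_not h, star_zero, zero_mul]
  src_mul a b n := by
    by_cases h : R a b
    · rw [F.total_of h]
      exact F.p_src_mul_s (n, ⟨(a, b), h⟩)
    · rw [F.total_of_not h, mul_zero]
  mul_rng a b n := by
    by_cases h : R a b
    · rw [F.total_of h]
      exact F.s_mul_p_rng (n, ⟨(a, b), h⟩)
    · rw [F.total_of_not h, zero_mul]

/-- The universal property of the graph algebra of `relGraph R`. -/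
theorem existsUnique_relLift {V : Type u} {A : Type*} [NonUnitalCStarAlgebra A]
    {R : V → V → Prop} {p : V → A} {s : V → V → ℕ → A} (h : IsRelFamily R p s) :
    ∃! φ : (relGraph R).GraphAlgebra →⋆ₙₐ[ℂ] A,
      (∀ a, φ ((GraphAlgebra.fam (relGraph R)).p a) = p a) ∧
      ∀ a b n, φ ((GraphAlgebra.fam (relGraph R)).total a b n) = s a b n := by
  obtain ⟨φ, ⟨hp, hs⟩, huniq⟩ := GraphAlgebra.existsUnique_lift h.toCKFamily
  refine ⟨φ, ⟨hp, fun a b n => ?_⟩, fun ψ hψ => huniq ψ ⟨hψ.1, fun e => ?_⟩⟩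
  · by_cases hR : R a b
    · rw [CKFamily.total_of _ hR]
      exact hs _
    · rw [CKFamily.total_of_not _ hR, map_zero, h.eq_zero _ _ _ hR]
  · have := hψ.2 e.2.1.1 e.2.1.2 e.1
    rwa [CKFamily.total_of _ e.2.2] at this

/-! ### Regrouping edges along a path of length two -/

section AddEdges

open Classical in
/-- The partial isometries of the family with countably many additional edges from `x` to `z`: the
edges from `x` to `y` are cut along the range projection of the edge `y → z` and regrouped. -/
noncomputable def addEdges {V : Type u} {A : Type*} [NonUnitalCStarAlgebra A] (x y z : V)
    (p : V → A) (s : V → V → ℕ → A) (a b : V) (n : ℕ) : A :=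
  if a = x ∧ b = y then
    s x y n * (p y - s y z 0 * star (s y z 0)) + s x y (2 * n + 1) * (s y z 0 * star (s y z 0))
  else if a = x ∧ b = z then s x y (2 * n) * s y z 0
  else s a b n

open Classical in
/-- The inverse of `addEdges`. -/
noncomputable def removeEdges {V : Type u} {A : Type*} [NonUnitalCStarAlgebra A] (x y z : V)
    (p : V → A) (s : V → V → ℕ → A) (a b : V) (n : ℕ) : A :=
  if a = x ∧ b = y then
    s x y n * (p y - s y z 0 * star (s y z 0)) +
      if n % 2 = 1 then s x y (n / 2) * (s y z 0 * star (s y z 0))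
      else s x z (n / 2) * star (s y z 0)
  else if a = x ∧ b = z then 0
  else s a b n

variable {V : Type u} {A B : Type*} [NonUnitalCStarAlgebra A] [NonUnitalCStarAlgebra B]
  {R : V → V → Prop} {p : V → A} {s : V → V → ℕ → A} {x y z : V}

/-- The new edges are `*`-polynomials in the old generators. This lets composites of the induced
homomorphisms be computed on generators. -/
theorem map_addEdges (φ : A →⋆ₙₐ[ℂ] B) (a b : V) (n : ℕ) :
    φ (addEdges x y z p s a b n) =
      addEdges x y z (fun a => φ (p a)) (fun a b n => φ (s a b n)) a b n := by
  unfold addEdges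
  split_ifs <;> simp only [map_add, map_mul, map_sub, map_star]

theorem map_removeEdges (φ : A →⋆ₙₐ[ℂ] B) (a b : V) (n : ℕ) :
    φ (removeEdges x y z p s a b n) =
      removeEdges x y z (fun a => φ (p a)) (fun a b n => φ (s a b n)) a b n := by
  unfold removeEdges
  split_ifs <;> simp only [map_add, map_mul, map_sub, map_star, map_zero]

namespace IsRelFamily

/-- Products of edges from `a` to `b`, multiplied from the right by elements of the corner. -/
theorem star_mul_mul (h : IsRelFamily R p s) {a b : V} (hab : R a b) (m n : ℕ) (c d : A)
    (hd : p b * d = d) :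
    star (s a b m * c) * (s a b n * d) = if m = n then star c * d else 0 := by
  rw [star_mul, mul_assoc, ← mul_assoc (star (s a b m))]
  split_ifs with hmn
  · rw [hmn, h.star_mul_self a b n hab, hd]
  · rw [h.star_mul_of_ne _ _ _ _ _ _ (by simp [hmn]), zero_mul, mul_zero]

theorem star_mul_mul_of_ne (h : IsRelFamily R p s) {a b a' b' : V} (hne : (a, b) ≠ (a', b'))
    (m n : ℕ) (c d : A) : star (s a b m * c) * (s a' b' n * d) = 0 := by
  rw [star_mul, mul_assoc, ← mul_assoc (star (s a b m)),
    h.star_mul_of_ne _ _ _ _ _ _ (fun he => hne ?_), zero_mul, mul_zero]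
  simp only [Prod.mk.injEq] at he ⊢
  exact ⟨he.1, he.2.1⟩

theorem star_mul_right_of_ne (h : IsRelFamily R p s) {a b a' b' : V} (hne : (a, b) ≠ (a', b'))
    (m n : ℕ) (d : A) : star (s a' b' n * d) * s a b m = 0 := by
  rw [← h.mul_rng a b m]
  exact h.star_mul_mul_of_ne hne.symm _ _ _ _

/-- The relations between the range projection of an edge and the complementary projection. -/
theorem cut_relations (h : IsRelFamily R p s) (hyz : R y z) {f Q q : A} (hf : f = s y z 0)
    (hQ : Q = f * star f) (hq : q = p y - Q) :
    (star Q = Q ∧ star q = q ∧ p y * f = f ∧ p y * Q = Q ∧ p y * q = q ∧ Q * p y = Q ∧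
      q * p y = q) ∧
    star f * f = p z ∧ f * star f = Q ∧ Q * Q = Q ∧ q * q = q ∧ Q * q = 0 ∧ q * Q = 0 ∧
      q + Q = p y ∧ Q * f = f ∧ q * f = 0 ∧ star f * Q = star f ∧ star f * q = 0 := by
  have hff : star f * f = p z := by rw [hf, h.star_mul_self _ _ _ hyz]
  have hfz : f * p z = f := by rw [hf, h.mul_rng]
  have hyf : p y * f = f := by rw [hf, h.src_mul]
  have hQs : star Q = Q := by rw [hQ, star_mul, star_star]
  have hqs : star q = q := by rw [hq, star_sub, hQs, h.star_p]
  have hQf : Q * f = f := by rw [hQ, mul_assoc, hff, hfz]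
  have hyQ : p y * Q = Q := by rw [hQ, ← mul_assoc, hyf]
  have hQy : Q * p y = Q := by simpa [hQs, h.star_p] using congrArg star hyQ
  have hQQ : Q * Q = Q := by
    conv_lhs => rw [hQ, ← mul_assoc, ← hQ, hQf]
    exact hQ.symm
  have hqf : q * f = 0 := by rw [hq, sub_mul, hyf, hQf, sub_self]
  refine ⟨⟨hQs, hqs, hyf, hyQ, ?_, hQy, ?_⟩, hff, hQ.symm, hQQ, ?_, ?_, ?_, ?_, hQf, hqf, ?_, ?_⟩
  · rw [hq, mul_sub, hyQ, h.p_mul_p]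
  · rw [hq, sub_mul, hQy, h.p_mul_p]
  · rw [hq, mul_sub, sub_mul, sub_mul, hyQ, hQy, hQQ, h.p_mul_p, sub_self, sub_zero]
  · rw [hq, mul_sub, hQy, hQQ, sub_self]
  · rw [hq, sub_mul, hyQ, hQQ, sub_self]
  · rw [hq, sub_add_cancel]
  · simpa [hQs] using congrArg star hQf
  · simpa [hqs] using congrArg star hqf

/-- To check orthogonality of a family that differs from a given one only between `x` and `y` and
between `x` and `z`, it suffices to look at products with the changed edges. -/
theorem star_mul_of_ne_of_modify (h : IsRelFamily R p s) (t : V → V → ℕ → A)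
    (ht : ∀ a b n, (a, b) ≠ (x, y) → (a, b) ≠ (x, z) → t a b n = s a b n)
    (hyy : ∀ m n, m ≠ n → star (t x y m) * t x y n = 0)
    (hyz : y ≠ z → ∀ m n, star (t x y m) * t x z n = 0)
    (hzz : ∀ m n, m ≠ n → star (t x z m) * t x z n = 0)
    (hys : ∀ a b m n, (a, b) ≠ (x, y) → (a, b) ≠ (x, z) → star (t x y m) * s a b n = 0)
    (hzs : ∀ a b m n, (a, b) ≠ (x, y) → (a, b) ≠ (x, z) → star (t x z m) * s a b n = 0)
    (a b : V) (m : ℕ) (c d : V) (n : ℕ) (hne : (a, b, m) ≠ (c, d, n)) :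
    star (t a b m) * t c d n = 0 := by
  -- Taking adjoints, each mixed pair need only be checked in one order.
  have swap : ∀ u w : A, star u * w = 0 → star w * u = 0 := fun u w huw => by
    simpa using congrArg star huw
  by_cases h1 : (a, b) = (x, y)
  · obtain ⟨rfl, rfl⟩ := Prod.mk.inj h1
    by_cases h2 : (c, d) = (a, b)
    · obtain ⟨rfl, rfl⟩ := Prod.mk.inj h2
      exact hyy _ _ (by simpa using hne)
    · by_cases h3 : (c, d) = (a, z)
      · obtain ⟨rfl, rfl⟩ := Prod.mk.inj h3
        exact hyz (fun e => h2 (by rw [e])) _ _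
      · rw [ht _ _ _ h2 h3]
        exact hys _ _ _ _ h2 h3
  · by_cases h1' : (a, b) = (x, z)
    · obtain ⟨rfl, rfl⟩ := Prod.mk.inj h1'
      by_cases h2 : (c, d) = (a, y)
      · obtain ⟨rfl, rfl⟩ := Prod.mk.inj h2
        exact swap _ _ (hyz (fun e => h1 (by rw [e])) _ _)
      · by_cases h3 : (c, d) = (a, b)
        · obtain ⟨rfl, rfl⟩ := Prod.mk.inj h3
          exact hzz _ _ (by simpa using hne)
        · rw [ht _ _ _ h2 h3]
          exact hzs _ _ _ _ h2 h3
    · rw [ht _ _ _ h1 h1']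
      by_cases h2 : (c, d) = (x, y)
      · obtain ⟨rfl, rfl⟩ := Prod.mk.inj h2
        exact swap _ _ (hys _ _ _ _ h1 h1')
      · by_cases h3 : (c, d) = (x, z)
        · obtain ⟨rfl, rfl⟩ := Prod.mk.inj h3
          exact swap _ _ (hzs _ _ _ _ h1 h1')
        · rw [ht _ _ _ h2 h3]
          exact h.star_mul_of_ne _ _ _ _ _ _ hne

/-- Adding edges from `x` to `z` along edges `x → y → z`. -/
theorem addEdges (h : IsRelFamily R p s) (hxy : R x y) (hyz : R y z) (hxz : ¬ R x z) :
    IsRelFamily (fun a b => R a b ∨ (a = x ∧ b = z)) p (addEdges x y z p s) := by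
  -- This keeps the two modified pairs `(x, y)` and `(x, z)` distinct; `x = z` remains possible.
  have hne : y ≠ z := fun e => hxz (e ▸ hxy)
  obtain ⟨f, hf⟩ : ∃ f, f = s y z 0 := ⟨_, rfl⟩
  obtain ⟨Q, hQ⟩ : ∃ Q, Q = f * star f := ⟨_, rfl⟩
  obtain ⟨q, hq⟩ : ∃ q, q = p y - Q := ⟨_, rfl⟩
  have ey : ∀ n, DirGraph.addEdges x y z p s x y n = s x y n * q + s x y (2 * n + 1) * Q := by
    intro n
    rw [DirGraph.addEdges, if_pos ⟨rfl, rfl⟩, hq, hQ, hf]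
  have ez : ∀ n, DirGraph.addEdges x y z p s x z n = s x y (2 * n) * f := by
    intro n
    rw [DirGraph.addEdges, if_neg (fun e => hne e.2.symm), if_pos ⟨rfl, rfl⟩, hf]
  have eo : ∀ a b n, (a, b) ≠ (x, y) → (a, b) ≠ (x, z) →
      DirGraph.addEdges x y z p s a b n = s a b n := by
    intro a b n h1 h2
    rw [DirGraph.addEdges, if_neg (by simpa using h1), if_neg (by simpa using h2)]
  obtain ⟨⟨hQs, hqs, hyf, hyQ, hyq, hQy, hqy⟩, hff, hQ', hQQ, hqq, hQq, hqQ, hqQ1, hQf, hqf, hfQ,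
    hfq⟩ := h.cut_relations hyz hf hQ hq
  have hfz : f * p z = f := by rw [hf, h.mul_rng]
  -- The mixed terms vanish because `q Q = Q q = 0`; for `m = n` the other two add up to `q + Q = p
  -- y`.
  have byy : ∀ m n, star (DirGraph.addEdges x y z p s x y m) * DirGraph.addEdges x y z p s x y n =
      if m = n then p y else 0 := by
    intro m n
    rw [ey, ey, star_add, add_mul, mul_add, mul_add]
    simp only [h.star_mul_mul hxy _ _ _ _ hyq, h.star_mul_mul hxy _ _ _ _ hyQ, hQs, hqs, hqq,
      hqQ, hQq, hQQ, ite_self, add_zero, zero_add]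
    by_cases hmn : m = n
    · simp [hmn, hqQ1]
    · simp [hmn]
  have bzz : ∀ m n, star (DirGraph.addEdges x y z p s x z m) * DirGraph.addEdges x y z p s x z n =
      if m = n then p z else 0 := by
    intro m n
    rw [ez, ez, h.star_mul_mul hxy _ _ _ _ hyf, hff]
    simp
  have cases3 : ∀ a b, (a, b) = (x, y) ∨ (a, b) = (x, z) ∨ ((a, b) ≠ (x, y) ∧ (a, b) ≠ (x, z)) := by
    intro a b
    tauto
  refine ⟨h.isStarProjection, h.orthogonal, ?_, ?_, ?_, ?_, ?_⟩
  · intro a b n hR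
    push Not at hR
    rw [eo, h.eq_zero _ _ _ hR.1]
    · rintro ⟨⟩
      exact hR.1 hxy
    · rintro ⟨⟩
      exact hR.2 rfl rfl
  · intro a b n hR
    rcases cases3 a b with h1 | h1 | h1
    · obtain ⟨rfl, rfl⟩ := Prod.mk.inj h1
      rw [byy, if_pos rfl]
    · obtain ⟨rfl, rfl⟩ := Prod.mk.inj h1
      rw [bzz, if_pos rfl]
    · rw [eo _ _ _ h1.1 h1.2]
      refine h.star_mul_self _ _ _ (hR.resolve_right fun e => h1.2 ?_)
      rw [e.1, e.2]
  · refine h.star_mul_of_ne_of_modify _ eo ?_ ?_ ?_ ?_ ?_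
    · intro m n hmn
      rw [byy, if_neg hmn]
    -- The `q`-part dies by `q f = 0`, the `Q`-part because odd and even indices never agree.
    · intro _ m n
      rw [ey, ez, star_add, add_mul, h.star_mul_mul hxy _ _ _ _ hyf,
        h.star_mul_mul hxy _ _ _ _ hyf, hqs, hqf, if_neg (by omega : ¬ 2 * m + 1 = 2 * n), ite_self,
        add_zero]
    · intro m n hmn
      rw [bzz, if_neg hmn]
    · intro a b m n h1 _
      rw [ey, star_add, add_mul, h.star_mul_right_of_ne h1, h.star_mul_right_of_ne h1, add_zero]
    · intro a b m n h1 _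
      rw [ez, h.star_mul_right_of_ne h1]
  · intro a b n
    rcases cases3 a b with h1 | h1 | h1
    · obtain ⟨rfl, rfl⟩ := Prod.mk.inj h1
      rw [ey, mul_add, ← mul_assoc, ← mul_assoc, h.src_mul, h.src_mul]
    · obtain ⟨rfl, rfl⟩ := Prod.mk.inj h1
      rw [ez, ← mul_assoc, h.src_mul]
    · rw [eo _ _ _ h1.1 h1.2, h.src_mul]
  · intro a b n
    rcases cases3 a b with h1 | h1 | h1
    · obtain ⟨rfl, rfl⟩ := Prod.mk.inj h1
      rw [ey, add_mul, mul_assoc, mul_assoc, hqy, hQy]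
    · obtain ⟨rfl, rfl⟩ := Prod.mk.inj h1
      rw [ez, mul_assoc, hfz]
    · rw [eo _ _ _ h1.1 h1.2, h.mul_rng]

/-- Removing edges from `x` to `z` along edges `x → y → z`. -/
theorem removeEdges (h : IsRelFamily (fun a b => R a b ∨ (a = x ∧ b = z)) p s)
    (hxy : R x y) (hyz : R y z) (hxz : ¬ R x z) :
    IsRelFamily R p (removeEdges x y z p s) := by
  have hne : y ≠ z := fun e => hxz (e ▸ hxy)
  have hne' : (x, y) ≠ (x, z) := by simpa using hne
  obtain ⟨f, hf⟩ : ∃ f, f = s y z 0 := ⟨_, rfl⟩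
  obtain ⟨Q, hQ⟩ : ∃ Q, Q = f * star f := ⟨_, rfl⟩
  obtain ⟨q, hq⟩ : ∃ q, q = p y - Q := ⟨_, rfl⟩
  -- `r n` is the reconstructed `Q`-part of the edge `x → y` with index `n`: odd indices come from
  -- edges `x → y`, even ones from edges `x → z` with `f` undone.
  obtain ⟨r, hr⟩ : ∃ r : ℕ → A, r = fun n => if n % 2 = 1 then s x y (n / 2) * Q
    else s x z (n / 2) * star f := ⟨_, rfl⟩
  have r1 : ∀ n, n % 2 = 1 → r n = s x y (n / 2) * Q := fun n hn => by rw [hr]; exact if_pos hn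
  have r0 : ∀ n, ¬ n % 2 = 1 → r n = s x z (n / 2) * star f := fun n hn => by
    rw [hr]; exact if_neg hn
  have ey : ∀ n, DirGraph.removeEdges x y z p s x y n = s x y n * q + r n := by
    intro n
    rw [DirGraph.removeEdges, if_pos ⟨rfl, rfl⟩, hr, hq, hQ, hf]
  have ez : ∀ n, DirGraph.removeEdges x y z p s x z n = 0 := by
    intro n
    rw [DirGraph.removeEdges, if_neg (fun e => hne e.2.symm), if_pos ⟨rfl, rfl⟩]
  have eo : ∀ a b n, (a, b) ≠ (x, y) → (a, b) ≠ (x, z) →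
      DirGraph.removeEdges x y z p s a b n = s a b n := by
    intro a b n h1 h2
    rw [DirGraph.removeEdges, if_neg (by simpa using h1), if_neg (by simpa using h2)]
  obtain ⟨⟨hQs, hqs, hyf, hyQ, hyq, hQy, hqy⟩, hff, hQ', hQQ, hqq, hQq, hqQ, hqQ1, hQf, hqf, hfQ,
    hfq⟩ := h.cut_relations (Or.inl hyz) hf hQ hq
  have hfz : p z * star f = star f := by
    have hfz : f * p z = f := by rw [hf, h.mul_rng]
    simpa [h.star_p] using congrArg star hfz
  have hfy : star f * p y = star f := by simpa [h.star_p] using congrArg star hyf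
  have hxy' : R x y ∨ (x = x ∧ y = z) := Or.inl hxy
  have hxz' : R x z ∨ (x = x ∧ z = z) := Or.inr ⟨rfl, rfl⟩
  -- Indices of different parity use edges with different ranges; for equal parity, the halves agree
  -- exactly when the indices do.
  have brr : ∀ m n, star (r m) * r n = if m = n then Q else 0 := by
    intro m n
    by_cases hm : m % 2 = 1 <;> by_cases hn : n % 2 = 1
    · rw [r1 m hm, r1 n hn, h.star_mul_mul hxy' _ _ _ _ hyQ, hQs, hQQ]
      exact if_congr (by omega) rfl rfl
    · rw [r1 m hm, r0 n hn, h.star_mul_mul_of_ne hne', if_neg (by omega)]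
    · rw [r0 m hm, r1 n hn, h.star_mul_mul_of_ne hne'.symm, if_neg (by omega)]
    · rw [r0 m hm, r0 n hn, h.star_mul_mul hxz' _ _ _ _ hfz, star_star, hQ']
      exact if_congr (by omega) rfl rfl
  have bqr : ∀ m n, star (s x y m * q) * r n = 0 := by
    intro m n
    by_cases hn : n % 2 = 1
    · rw [r1 n hn, h.star_mul_mul hxy' _ _ _ _ hyQ, hqs, hqQ, ite_self]
    · rw [r0 n hn, h.star_mul_mul_of_ne hne']
  have brq : ∀ m n, star (r m) * (s x y n * q) = 0 := by
    intro m n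
    simpa only [star_mul, star_star, star_zero] using congrArg star (bqr n m)
  have byy : ∀ m n, star (DirGraph.removeEdges x y z p s x y m) *
      DirGraph.removeEdges x y z p s x y n = if m = n then p y else 0 := by
    intro m n
    rw [ey, ey, star_add, add_mul, mul_add, mul_add, bqr, brq, brr, h.star_mul_mul hxy' _ _ _ _ hyq,
      hqs, hqq]
    by_cases hmn : m = n
    · simp [hmn, hqQ1]
    · simp [hmn]
  have cases3 : ∀ a b, (a, b) = (x, y) ∨ (a, b) = (x, z) ∨ ((a, b) ≠ (x, y) ∧ (a, b) ≠ (x, z)) := by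
    intro a b
    tauto
  refine ⟨h.isStarProjection, h.orthogonal, ?_, ?_, ?_, ?_, ?_⟩
  · intro a b n hR
    rcases cases3 a b with h1 | h1 | h1
    · obtain ⟨rfl, rfl⟩ := Prod.mk.inj h1
      exact absurd hxy hR
    · obtain ⟨rfl, rfl⟩ := Prod.mk.inj h1
      exact ez n
    · rw [eo _ _ _ h1.1 h1.2, h.eq_zero]
      rintro (h2 | ⟨rfl, rfl⟩)
      · exact hR h2
      · exact h1.2 rfl
  · intro a b n hR
    rcases cases3 a b with h1 | h1 | h1
    · obtain ⟨rfl, rfl⟩ := Prod.mk.inj h1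
      rw [byy, if_pos rfl]
    · obtain ⟨rfl, rfl⟩ := Prod.mk.inj h1
      exact absurd hR hxz
    · rw [eo _ _ _ h1.1 h1.2]
      exact h.star_mul_self _ _ _ (Or.inl hR)
  · refine h.star_mul_of_ne_of_modify _ eo ?_ ?_ ?_ ?_ ?_
    · intro m n hmn
      rw [byy, if_neg hmn]
    · intro _ m n
      rw [ez, mul_zero]
    · intro m n _
      rw [ez n, mul_zero]
    · intro a b m n h1 h2
      rw [ey, star_add, add_mul, h.star_mul_right_of_ne h1, zero_add]
      by_cases hm : m % 2 = 1
      · rw [r1 m hm, h.star_mul_right_of_ne h1]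
      · rw [r0 m hm, h.star_mul_right_of_ne h2]
    · intro a b m n _ _
      rw [ez, star_zero, zero_mul]
  · intro a b n
    rcases cases3 a b with h1 | h1 | h1
    · obtain ⟨rfl, rfl⟩ := Prod.mk.inj h1
      rw [ey, mul_add, ← mul_assoc, h.src_mul]
      by_cases hn : n % 2 = 1
      · rw [r1 n hn, ← mul_assoc, h.src_mul]
      · rw [r0 n hn, ← mul_assoc, h.src_mul]
    · obtain ⟨rfl, rfl⟩ := Prod.mk.inj h1
      rw [ez, mul_zero]
    · rw [eo _ _ _ h1.1 h1.2, h.src_mul]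
  · intro a b n
    rcases cases3 a b with h1 | h1 | h1
    · obtain ⟨rfl, rfl⟩ := Prod.mk.inj h1
      rw [ey, add_mul, mul_assoc, hqy]
      by_cases hn : n % 2 = 1
      · rw [r1 n hn, mul_assoc, hQy]
      · rw [r0 n hn, mul_assoc, hfy]
    · obtain ⟨rfl, rfl⟩ := Prod.mk.inj h1
      rw [ez, zero_mul]
    · rw [eo _ _ _ h1.1 h1.2, h.mul_rng]

/-! ### The two regroupings are mutually inverse -/

theorem removeEdges_addEdges (h : IsRelFamily R p s) (hxy : R x y) (hyz : R y z) (hxz : ¬ R x z)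
    (a b : V) (n : ℕ) :
    DirGraph.removeEdges x y z p (DirGraph.addEdges x y z p s) a b n = s a b n := by
  have hne : z ≠ y := fun e => hxz (e ▸ hxy)
  -- Hence the edge `f` from `y` to `z` is itself unmodified, and both constructions cut along the
  -- same projection `Q`.
  have hne2 : y ≠ x := fun e => hxz (e ▸ hyz)
  obtain ⟨⟨-, -, -, -, -, -, -⟩, -, -, hQQ, hqq, hQq, hqQ, hqQ1, -, -, -, -⟩ :=
    h.cut_relations hyz rfl rfl rfl
  have hxyn : s x y n * (p y - s y z 0 * star (s y z 0)) + s x y n * (s y z 0 * star (s y z 0)) =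
      s x y n := by
    rw [← mul_add, hqQ1, h.mul_rng]
  have hassoc : ∀ c, c * s y z 0 * star (s y z 0) = c * (s y z 0 * star (s y z 0)) :=
    fun c => mul_assoc _ _ _
  unfold DirGraph.removeEdges DirGraph.addEdges
  simp only [hne, hne2, true_and, and_true, if_true, if_false, and_self]
  generalize s y z 0 * star (s y z 0) = Q at *
  generalize p y - Q = q at *
  -- For `x → y`, the `q`-part is untouched and the `Q`-part returns as index `2 * (n / 2) + 1` or
  -- `2 * (n / 2)`, which is `n` by parity. For `x → z` both sides vanish.
  split_ifs with h1 h2 h2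
  · rw [h1.1, h1.2, add_mul, add_mul, mul_assoc, mul_assoc, mul_assoc, mul_assoc, hqq, hQq, hqQ,
      hQQ, show 2 * (n / 2) + 1 = n by omega, mul_zero, mul_zero, add_zero, zero_add, hxyn]
  · rw [h1.1, h1.2, hassoc, add_mul, mul_assoc, mul_assoc, hqq, hQq,
      show 2 * (n / 2) = n by omega, mul_zero, add_zero, hxyn]
  · rw [h2.1, h2.2, h.eq_zero _ _ _ hxz]
  · rfl

theorem addEdges_removeEdges (h : IsRelFamily (fun a b => R a b ∨ (a = x ∧ b = z)) p s)
    (hxy : R x y) (hyz : R y z) (hxz : ¬ R x z) (a b : V) (n : ℕ) :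
    DirGraph.addEdges x y z p (DirGraph.removeEdges x y z p s) a b n = s a b n := by
  have hne : z ≠ y := fun e => hxz (e ▸ hxy)
  have hne2 : y ≠ x := fun e => hxz (e ▸ hyz)
  obtain ⟨⟨-, -, -, -, -, -, -⟩, hff, -, hQQ, hqq, hQq, hqQ, hqQ1, -, hqf, hfQ, hfq⟩ :=
    h.cut_relations (Or.inl hyz) rfl rfl rfl
  unfold DirGraph.addEdges DirGraph.removeEdges
  simp only [hne, hne2, true_and, and_true, if_true, if_false, and_self,
    show ∀ n, (2 * n + 1) % 2 = 1 by omega, show ∀ n, ¬ (2 * n) % 2 = 1 by omega,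
    show ∀ n, (2 * n + 1) / 2 = n by omega, show ∀ n, (2 * n) / 2 = n by omega]
  by_cases h1 : a = x ∧ b = y
  · rw [if_pos h1, h1.1, h1.2]
    generalize s y z 0 * star (s y z 0) = Q at *
    generalize p y - Q = q at *
    -- The reconstructed part lives under `Q`, so cutting by `q` leaves only the original `q`-part.
    have hrq : (if n % 2 = 1 then s x y (n / 2) * Q else s x z (n / 2) * star (s y z 0)) * q =
        0 := by
      split_ifs
      · rw [mul_assoc, hQq, mul_zero]
      · rw [mul_assoc, hfq, mul_zero]
    rw [add_mul, add_mul, hrq, mul_assoc, mul_assoc, mul_assoc, hqq, hqQ, hQQ, mul_zero, add_zero,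
      zero_add, ← mul_add, hqQ1, h.mul_rng]
  · simp only [if_neg h1]
    by_cases h2 : a = x ∧ b = z
    -- Multiplying by `f` kills the `q`-part and undoes `star f`, since `star f * f = p z`.
    · rw [if_pos h2, h2.1, h2.2, add_mul, mul_assoc, mul_assoc, hqf, hff, mul_zero, zero_add,
        h.mul_rng]
    · rw [if_neg h2, if_neg h2]

theorem map_removeEdges_eq (h : IsRelFamily R p s) (hxy : R x y) (hyz : R y z) (hxz : ¬ R x z)
    {p' : V → B} {s' : V → V → ℕ → B} (φ : B →⋆ₙₐ[ℂ] A) (hp : ∀ a, φ (p' a) = p a)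
    (hs : ∀ a b n, φ (s' a b n) = DirGraph.addEdges x y z p s a b n) (a b : V) (n : ℕ) :
    φ (DirGraph.removeEdges x y z p' s' a b n) = s a b n := by
  rw [map_removeEdges]
  simp only [hp, hs]
  exact h.removeEdges_addEdges hxy hyz hxz a b n

theorem map_addEdges_eq (h : IsRelFamily (fun a b => R a b ∨ (a = x ∧ b = z)) p s)
    (hxy : R x y) (hyz : R y z) (hxz : ¬ R x z)
    {p' : V → B} {s' : V → V → ℕ → B} (φ : B →⋆ₙₐ[ℂ] A) (hp : ∀ a, φ (p' a) = p a)
    (hs : ∀ a b n, φ (s' a b n) = DirGraph.removeEdges x y z p s a b n) (a b : V) (n : ℕ) :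
    φ (DirGraph.addEdges x y z p' s' a b n) = s a b n := by
  rw [map_addEdges]
  simp only [hp, hs]
  exact h.addEdges_removeEdges hxy hyz hxz a b n

end IsRelFamily

end AddEdges

/-! ### From a single step to the transitive closure -/

theorem nonempty_equiv_of_step {V : Type u} {R : V → V → Prop} {x y z : V} (hxy : R x y)
    (hyz : R y z) (hxz : ¬ R x z) :
    Nonempty ((relGraph R).GraphAlgebra ≃⋆ₐ[ℂ]
      (relGraph fun a b => R a b ∨ (a = x ∧ b = z)).GraphAlgebra) := by
  set R' : V → V → Prop := fun a b => R a b ∨ (a = x ∧ b = z) with hR'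
  have h := (GraphAlgebra.fam (relGraph R)).isRelFamily
  have h' := (GraphAlgebra.fam (relGraph R')).isRelFamily
  obtain ⟨φ, ⟨hφp, hφs⟩, -⟩ := existsUnique_relLift (h'.removeEdges hxy hyz hxz)
  obtain ⟨ψ, ⟨hψp, hψs⟩, -⟩ := existsUnique_relLift (h.addEdges hxy hyz hxz)
  -- Both maps lift the universal family itself, so they agree by uniqueness.
  have h1 : ψ.comp φ = NonUnitalStarAlgHom.id ℂ _ := by
    refine (existsUnique_relLift h).unique ⟨fun a => ?_, fun a b n => ?_⟩
      ⟨fun _ => rfl, fun _ _ _ => rfl⟩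
    · exact (congrArg ψ (hφp a)).trans (hψp a)
    · refine (congrArg ψ (hφs a b n)).trans ?_
      exact h.map_removeEdges_eq hxy hyz hxz ψ hψp hψs a b n
  have h2 : φ.comp ψ = NonUnitalStarAlgHom.id ℂ _ := by
    refine (existsUnique_relLift h').unique ⟨fun a => ?_, fun a b n => ?_⟩
      ⟨fun _ => rfl, fun _ _ _ => rfl⟩
    · exact (congrArg φ (hψp a)).trans (hφp a)
    · refine (congrArg φ (hψs a b n)).trans ?_
      exact h'.map_addEdges_eq hxy hyz hxz φ hφp hφs a b n
  exact ⟨StarAlgEquiv.ofBijective φ ⟨Function.LeftInverse.injective fun a => DFunLike.congr_fun h1 a,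
    Function.RightInverse.surjective fun a => DFunLike.congr_fun h2 a⟩⟩

theorem nonempty_equiv_transGen {V : Type u} [Finite V] (R : V → V → Prop) :
    Nonempty ((relGraph R).GraphAlgebra ≃⋆ₐ[ℂ] (relGraph (Relation.TransGen R)).GraphAlgebra) := by
  -- The measure is the number of unrelated pairs; adding `(x, z)` lowers it.
  induction hn : {e : V × V | ¬ R e.1 e.2}.ncard using Nat.strong_induction_on generalizing R with
  | _ n ih =>
  by_cases htrans : ∀ x y z, R x y → R y z → R x z
  · have : IsTrans V R := ⟨htrans⟩
    rw [Relation.transGen_eq_self]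
    exact ⟨StarAlgEquiv.refl ..⟩
  · push Not at htrans
    obtain ⟨x, y, z, hxy, hyz, hxz⟩ := htrans
    obtain ⟨Φ⟩ := nonempty_equiv_of_step hxy hyz hxz
    have hlt : {e : V × V | ¬ (R e.1 e.2 ∨ (e.1 = x ∧ e.2 = z))}.ncard < n := by
      rw [← hn]
      refine Set.ncard_lt_ncard ⟨fun e he hR => he (Or.inl hR), fun hsub => ?_⟩ (Set.toFinite _)
      exact hsub (show (x, z) ∈ {e : V × V | ¬ R e.1 e.2} from hxz) (Or.inr ⟨rfl, rfl⟩)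
    obtain ⟨Ψ⟩ := ih _ hlt (fun a b => R a b ∨ (a = x ∧ b = z)) rfl
    -- Each use of the added pair can be replaced by the path `x → y → z`.
    have heq : Relation.TransGen (fun a b => R a b ∨ (a = x ∧ b = z)) = Relation.TransGen R := by
      ext a b
      constructor <;> intro hab
      · induction hab with
        | single hc =>
          rcases hc with hc | ⟨rfl, rfl⟩
          · exact .single hc
          · exact .tail (.single hxy) hyz
        | tail _ hc ih' =>
          rcases hc with hc | ⟨rfl, rfl⟩
          · exact ih'.tail hc
          · exact (ih'.tail hxy).tail hyz
      · induction hab with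
        | single hc => exact .single (Or.inl hc)
        | tail _ hc ih' => exact ih'.tail (Or.inl hc)
    rw [heq] at Ψ
    exact ⟨Φ.trans Ψ⟩

theorem hasEdge_transClosure (G : DirGraph.{u, v}) :
    G.transClosure.HasEdge = Relation.TransGen G.HasEdge := by
  funext a b
  refine propext ⟨?_, fun h => ?_⟩
  · rintro ⟨e | e, rfl, rfl⟩
    · exact .single ⟨e, rfl, rfl⟩
    · exact e.2.1
  · by_cases he : G.HasEdge a b
    · obtain ⟨e, h1, h2⟩ := he
      exact ⟨Sum.inl e, h1, h2⟩
    · exact ⟨Sum.inr ⟨(a, b), h, he⟩, rfl, rfl⟩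

theorem nonempty_equiv_amplification (G : DirGraph.{u, v}) [Finite G.V] :
    Nonempty (G.amplification.GraphAlgebra ≃⋆ₐ[ℂ]
      G.transClosure.amplification.GraphAlgebra) := by
  -- An amplification unfolds to `relGraph` of its edge relation, so equal relations give equal
  -- graphs.
  have h : relGraph (V := G.V) (Relation.TransGen G.HasEdge) = G.transClosure.amplification :=
    congrArg (fun R : G.V → G.V → Prop => relGraph R) G.hasEdge_transClosure.symm
  rw [← h]
  exact nonempty_equiv_transGen G.HasEdge

end DirGraph

theorem mainTheorem4 (G : DirGraph.{u, v}) [Finite G.V] :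
    Nonempty (G.amplification.GraphAlgebra ≃⋆ₐ[ℂ]
      G.transClosure.amplification.GraphAlgebra) :=
  DirGraph.nonempty_equiv_amplification G
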